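/- Let $(\Omega,\mathcal F,\mathbb P)$ be a probability space and let $\mathcal N=\{1,\dots,N\}$ be a set of clients. Rounds are numbered $t=1,2,\dots$. Each client $n$ has a fixed coefficient vector $\theta_n^*\in\mathbb R^3$, and for each round $t$ there are a random context $c_{t,n}\in\mathbb R^3$, a random selection indicator $x_{t,n}\in\{0,1\}$ (equal to $1$ when the scheduler selects client $n$ in round $t$, by an arbitrary selection policy) and a real random noise $\epsilon_{t,n}$. The model exchange time and its expectation given the context are $$\tau_{t,n}=c_{t,n}^\top\theta_n^*+\epsilon_{t,n},\qquad \tau^*_{t,n}=c_{t,n}^\top\theta_n^* .$$ Let $R\ge 0$, $S,L,\lambda>0$ and $\delta\in(0,1)$, and assume that, for all $t\ge 1$ and $n\in\mathcal N$: - $\|\theta_n^*\|_2\le S$, and $\|c_{t,n}\|_2\le L$ almost surely; - with $\mathcal G_{t,n}=\sigma(c_{1,n},\dots,c_{t,n},\,x_{1,n},\dots,x_{t,n},\,\epsilon_{1,n},\dots,\epsilon_{t-1,n})$, the noise is conditionally centred and $R$-sub-Gaussian: $\mathbb E[\epsilon_{t,n}\mid\mathcal G_{t,n}]=0$ and, for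 every $\Lambda\in\mathbb R$, $\mathbb E[e^{\Lambda\epsilon_{t,n}}\mid\mathcal G_{t,n}]\le e^{\Lambda^2R^2/2}$ almost surely; - $\tau_{t,n}>0$ almost surely. Put, for $T\ge 0$, $$H_{T,n}=\lambda I_3+\sum_{s=1}^{T}x_{s,n}c_{s,n}c_{s,n}^\top,\quad b_{T,n}=\sum_{s=1}^{T}x_{s,n}\tau_{s,n}c_{s,n},$$ and, for $t\ge 1$, $\hat\theta_{t,n}=H_{t-1,n}^{-1}b_{t-1,n}$. Write $\|v\|_M=\sqrt{v^\top Mv}$, set $$\alpha_t=R\sqrt{3\log\!\left(\frac{1+tL^2/\lambda}{\delta}\right)}+\lambda^{1/2}S,$$ and let the clipped UCB estimate be $$\bar\tau_{t,n}=\max\left\{c_{t,n}^\top\hat\theta_{t,n}-\alpha_t\|c_{t,n}\|_{H_{t-1,n}^{-1}},\,0\right\}.$$ Then for every client $n\in\mathcal N$, with probability at least $1-\delta$, the inequalities $$0\le\tau^*_{t,n}-\bar\tau_{t,n}\le 2\alpha_t\|c_{t,n}\|_{H_{t-1,n}^{-1}}$$ hold simultaneously for all rounds $t\ge1$. -/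

import Mathlib

open MeasureTheory ProbabilityTheory
open scoped Matrix

namespace ClientSelection

/-- The linear model `cᵀ θ` for the expected model exchange time. -/
noncomputable def expectedTime (c θ : EuclideanSpace ℝ (Fin 3)) : ℝ :=
  c.ofLp ⬝ᵥ θ.ofLp

/-- The indicator that client `n` is selected, `sel` being the set of selected clients. -/
def selInd {N : ℕ} (sel : Finset (Fin N)) (n : Fin N) : ℝ :=
  if n ∈ sel then 1 else 0

/-- The weighted (semi)norm of `v` with respect to the matrix `M`. -/
noncomputable def weightedNorm (M : Matrix (Fin 3) (Fin 3) ℝ) (v : EuclideanSpace ℝ (Fin 3)) : ℝ :=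
  √(v.ofLp ⬝ᵥ (M *ᵥ v.ofLp))

/-- The exploration parameter of round `t`. -/
noncomputable def explorationParam (R S L lam δ : ℝ) (t : ℕ) : ℝ :=
  R * √(3 * Real.log ((1 + (t : ℝ) * L ^ 2 / lam) / δ)) + √lam * S

section Model

variable {Ω : Type*} {N : ℕ}

/-- The model exchange time of client `n` in round `t`: linear model plus noise. -/
noncomputable def exchangeTime (c : ℕ → Fin N → Ω → EuclideanSpace ℝ (Fin 3))
    (θ : Fin N → EuclideanSpace ℝ (Fin 3)) (ε : ℕ → Fin N → Ω → ℝ)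
    (t : ℕ) (n : Fin N) (ω : Ω) : ℝ :=
  expectedTime (c t n ω) (θ n) + ε t n ω

/-- The regularised design matrix of client `n` after `T` rounds (rounds are numbered from `1`). -/
noncomputable def designMatrix (lam : ℝ) (c : ℕ → Fin N → Ω → EuclideanSpace ℝ (Fin 3))
    (sel : ℕ → Ω → Finset (Fin N)) (T : ℕ) (n : Fin N) (ω : Ω) : Matrix (Fin 3) (Fin 3) ℝ :=
  lam • (1 : Matrix (Fin 3) (Fin 3) ℝ) +
    ∑ s ∈ Finset.Icc 1 T,
      selInd (sel s ω) n • Matrix.vecMulVec (c s n ω).ofLp (c s n ω).ofLp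

/-- The response vector of client `n` after `T` rounds, for observed exchange times `τ`. -/
noncomputable def responseVec (c : ℕ → Fin N → Ω → EuclideanSpace ℝ (Fin 3))
    (sel : ℕ → Ω → Finset (Fin N)) (τ : ℕ → Fin N → Ω → ℝ) (T : ℕ) (n : Fin N) (ω : Ω) :
    Fin 3 → ℝ :=
  ∑ s ∈ Finset.Icc 1 T, (selInd (sel s ω) n * τ s n ω) • (c s n ω).ofLp

/-- The ridge regression estimate of the coefficients of client `n` available in round `t ≥ 1`;
it uses the rounds `1, …, t - 1` in which the client was selected. -/
noncomputable def ridgeEstimate (lam : ℝ) (c : ℕ → Fin N → Ω → EuclideanSpace ℝ (Fin 3))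
    (sel : ℕ → Ω → Finset (Fin N)) (τ : ℕ → Fin N → Ω → ℝ) (t : ℕ) (n : Fin N) (ω : Ω) :
    EuclideanSpace ℝ (Fin 3) :=
  WithLp.toLp 2 ((designMatrix lam c sel (t - 1) n ω)⁻¹ *ᵥ responseVec c sel τ (t - 1) n ω)

/-- The clipped optimistic (UCB) estimate of the exchange time of client `n` in round `t ≥ 1`,
with exploration parameters `α`. -/
noncomputable def ucbEstimate (lam : ℝ) (α : ℕ → ℝ)
    (c : ℕ → Fin N → Ω → EuclideanSpace ℝ (Fin 3))
    (sel : ℕ → Ω → Finset (Fin N)) (τ : ℕ → Fin N → Ω → ℝ) (t : ℕ) (n : Fin N) (ω : Ω) : ℝ :=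
  max (expectedTime (c t n ω) (ridgeEstimate lam c sel τ t n ω) -
    α t * weightedNorm (designMatrix lam c sel (t - 1) n ω)⁻¹ (c t n ω)) 0

/-- The information on client `n` just before its noise in round `t` is drawn: the σ-algebra
generated by its contexts and selection indicators of the rounds `1, …, t` and its noises of the
rounds `1, …, t - 1`. -/
@[reducible] def clientHistory (c : ℕ → Fin N → Ω → EuclideanSpace ℝ (Fin 3))
    (sel : ℕ → Ω → Finset (Fin N)) (ε : ℕ → Fin N → Ω → ℝ) (t : ℕ) (n : Fin N) :
    MeasurableSpace Ω :=
  (⨆ s ∈ Set.Icc 1 t, MeasurableSpace.comap (c s n) inferInstance) ⊔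
  (⨆ s ∈ Set.Icc 1 t, MeasurableSpace.comap (fun ω => selInd (sel s ω) n) inferInstance) ⊔
  (⨆ s ∈ Set.Ico 1 t, MeasurableSpace.comap (ε s n) inferInstance)

end Model

/-- `X` is conditionally `R`-sub-Gaussian given the σ-algebra `m`: all exponential moments are
finite and `E[exp(Λ X) | m] ≤ exp(Λ² R² / 2)` almost surely, for every real `Λ`. -/
def CondSubGaussian {Ω : Type*} {mΩ : MeasurableSpace Ω} (μ : Measure Ω) (m : MeasurableSpace Ω)
    (X : Ω → ℝ) (R : ℝ) : Prop :=
  ∀ Λ : ℝ, Integrable (fun ω => Real.exp (Λ * X ω)) μ ∧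
    ∀ᵐ ω ∂μ, (μ[fun ω' => Real.exp (Λ * X ω') | m]) ω ≤ Real.exp (Λ ^ 2 * R ^ 2 / 2)

end ClientSelection

/-! The proof is a self-normalised concentration bound by the method of mixtures. Write `y s` for
the context of round `s` times the selection indicator, `S T` for the sum of the `η s • y s`, and `H
T` for the regularised Gram matrix. The process `mixtureProcess`, `exp (Sᵀ H⁻¹ S / 2) * √(lam ^ d /
det H)`, is the average of `exp (∑ (uᵀ y s) η s - (uᵀ y s)² / 2)` over a centred Gaussian `u` of
covariance `lam⁻¹ I`. No `d`-dimensional integral is computed: by `mixtureProcess_succ` each step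
multiplies the process by a one-dimensional Gaussian average `gaussianMix a w η` with `a`, `w` known
before the noise is drawn, and `CondSubGaussian.lintegral_mul_gaussianMix_le` shows that such a
factor does not raise the mean.

Ville's inequality `ville_le` then keeps the process below `1 / δ` in all rounds, outside an event
of probability at most `δ`. There, a bound on `det H` gives `Sᵀ H⁻¹ S ≤ 3 log (⋯)`
(`inv_form_le_of_mixtureProcess_lt`), and Cauchy–Schwarz in the `H⁻¹` norm turns this into a bound
on the ridge prediction error (`abs_ridge_sub_le`). Clipping at `0` is harmless because the expected
time is almost surely nonnegative (`ae_expectedTime_nonneg`). -/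

namespace ClientSelection
open scoped ENNReal NNReal
open Filter Topology

/-! ### Exponential supermartingale steps and Ville's inequality -/

/-- Integration against an `m`-measurable weight only sees the conditional expectation. -/
lemma lintegral_mul_le_of_condExp_le {Ω : Type*} {m mΩ : MeasurableSpace Ω} {μ : Measure Ω}
    [IsFiniteMeasure μ] (hm : m ≤ mΩ) {f : Ω → ℝ} (hf : Integrable f μ) (hf0 : 0 ≤ f)
    (hfm : Measurable f) (hle : ∀ᵐ ω ∂μ, (μ[f | m]) ω ≤ 1) {Z : Ω → ℝ≥0∞}
    (hZ : Measurable[m] Z) :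
    ∫⁻ ω, Z ω * ENNReal.ofReal (f ω) ∂μ ≤ ∫⁻ ω, Z ω ∂μ := by
  have hfm' : Measurable fun ω => ENNReal.ofReal (f ω) := hfm.ennreal_ofReal
  have hZ' : Measurable Z := hZ.mono hm le_rfl
  -- On sets of `m`, the density `f` gives the same mass as its conditional expectation, which is at
  -- most `1`.
  have key : (μ.withDensity fun ω => ENNReal.ofReal (f ω)).trim hm ≤ μ.trim hm := by
    refine Measure.le_iff.2 fun s hs => ?_
    rw [trim_measurableSet_eq hm hs, trim_measurableSet_eq hm hs, withDensity_apply _ (hm s hs),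
      ← ofReal_integral_eq_lintegral_ofReal hf.integrableOn (ae_of_all _ hf0),
      ← setIntegral_condExp hm hf hs]
    calc ENNReal.ofReal (∫ ω in s, (μ[f | m]) ω ∂μ)
        ≤ ENNReal.ofReal (∫ _ in s, (1 : ℝ) ∂μ) := by
          refine ENNReal.ofReal_le_ofReal (setIntegral_mono_ae integrable_condExp.integrableOn
            (integrable_const 1).integrableOn hle)
      _ = μ s := by simp
  calc ∫⁻ ω, Z ω * ENNReal.ofReal (f ω) ∂μ
      = ∫⁻ ω, Z ω ∂(μ.withDensity fun ω => ENNReal.ofReal (f ω)) := by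
        rw [lintegral_withDensity_eq_lintegral_mul _ hfm' hZ']
        simp only [Pi.mul_apply, mul_comm]
    _ ≤ ∫⁻ ω, Z ω ∂μ := by
        rw [← lintegral_trim hm hZ, ← lintegral_trim hm hZ]
        exact lintegral_mono' key le_rfl

/-- The exponential bound for a fixed exponent, normalised. -/
lemma CondSubGaussian.lintegral_mul_exp_const_le {Ω : Type*} {m mΩ : MeasurableSpace Ω}
    {μ : Measure Ω} [IsFiniteMeasure μ] (hm : m ≤ mΩ) {η : Ω → ℝ} (hη : Measurable η)
    (hsub : CondSubGaussian μ m η 1) (v : ℝ) {Z : Ω → ℝ≥0∞} (hZ : Measurable[m] Z) :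
    ∫⁻ ω, Z ω * ENNReal.ofReal (Real.exp (v * η ω - v ^ 2 / 2)) ∂μ ≤ ∫⁻ ω, Z ω ∂μ := by
  have heq : (fun ω => Real.exp (v * η ω - v ^ 2 / 2)) =
      Real.exp (-(v ^ 2 / 2)) • fun ω => Real.exp (v * η ω) := by
    ext ω
    simp only [Pi.smul_apply, smul_eq_mul, ← Real.exp_add]
    ring_nf
  have hint : Integrable (fun ω => Real.exp (v * η ω - v ^ 2 / 2)) μ := by
    rw [heq]; exact (hsub v).1.smul _
  refine lintegral_mul_le_of_condExp_le hm hint (fun _ => (Real.exp_pos _).le) (by fun_prop) ?_ hZ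
  rw [heq]
  filter_upwards [condExp_smul (μ := μ) (Real.exp (-(v ^ 2 / 2)))
    (fun ω => Real.exp (v * η ω)) m, (hsub v).2] with ω h1 h2
  rw [h1, Pi.smul_apply, smul_eq_mul]
  calc _ ≤ Real.exp (-(v ^ 2 / 2)) * Real.exp (v ^ 2 * 1 ^ 2 / 2) := by gcongr
    _ = 1 := by rw [← Real.exp_add]; norm_num

/-- The exponential bound for an exponent known beforehand. -/
lemma CondSubGaussian.lintegral_mul_exp_le {Ω : Type*} {m mΩ : MeasurableSpace Ω}
    {μ : Measure Ω} [IsFiniteMeasure μ] (hm : m ≤ mΩ) {η : Ω → ℝ} (hη : Measurable η)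
    (hsub : CondSubGaussian μ m η 1) {h : Ω → ℝ} (hh : Measurable[m] h) {Z : Ω → ℝ≥0∞}
    (hZ : Measurable[m] Z) :
    ∫⁻ ω, Z ω * ENNReal.ofReal (Real.exp (h ω * η ω - h ω ^ 2 / 2)) ∂μ ≤ ∫⁻ ω, Z ω ∂μ := by
  classical
  have hZ' : Measurable Z := hZ.mono hm le_rfl
  -- On each fibre of a simple exponent the exponent is constant, and the `m`-measurable indicator
  -- of the fibre is absorbed into the weight `Z`.
  have simple : ∀ g : @SimpleFunc Ω m ℝ,
      ∫⁻ ω, Z ω * ENNReal.ofReal (Real.exp (g ω * η ω - g ω ^ 2 / 2)) ∂μ ≤ ∫⁻ ω, Z ω ∂μ := by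
    intro g
    have hset : ∀ v, MeasurableSet[m] (g ⁻¹' {v}) := fun v => @SimpleFunc.measurableSet_fiber Ω ℝ m g v
    have split : ∀ F : ℝ → Ω → ℝ≥0∞, ∀ ω,
        F (g ω) ω = ∑ v ∈ @SimpleFunc.range Ω ℝ m g, (g ⁻¹' {v}).indicator (F v) ω := by
      intro F ω
      rw [Finset.sum_eq_single (g ω)]
      · simp
      · intro b _ hb
        simp [Set.indicator, hb.symm]
      · intro hn
        exact absurd (@SimpleFunc.mem_range_self Ω ℝ m g ω) hn
    have e1 : ∀ ω, Z ω * ENNReal.ofReal (Real.exp (g ω * η ω - g ω ^ 2 / 2)) =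
        ∑ v ∈ @SimpleFunc.range Ω ℝ m g,
          (g ⁻¹' {v}).indicator Z ω * ENNReal.ofReal (Real.exp (v * η ω - v ^ 2 / 2)) := by
      intro ω
      rw [split (fun v ω => Z ω * ENNReal.ofReal (Real.exp (v * η ω - v ^ 2 / 2))) ω]
      refine Finset.sum_congr rfl fun v _ => ?_
      by_cases hv : ω ∈ g ⁻¹' {v}
      · simp only [Set.indicator_of_mem hv]
      · simp only [Set.indicator_of_notMem hv, zero_mul]
    have e2 : ∀ ω, Z ω = ∑ v ∈ @SimpleFunc.range Ω ℝ m g, (g ⁻¹' {v}).indicator Z ω :=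
      fun ω => split (fun _ => Z) ω
    have hind : ∀ v, Measurable[m] ((g ⁻¹' {v}).indicator Z) := fun v => hZ.indicator (hset v)
    calc _ = ∑ v ∈ @SimpleFunc.range Ω ℝ m g, ∫⁻ ω, (g ⁻¹' {v}).indicator Z ω *
          ENNReal.ofReal (Real.exp (v * η ω - v ^ 2 / 2)) ∂μ := by
          rw [← lintegral_finsetSum']
          · exact lintegral_congr e1
          · intro v _
            exact (((hind v).mono hm le_rfl).mul (by fun_prop)).aemeasurable
      _ ≤ ∑ v ∈ @SimpleFunc.range Ω ℝ m g, ∫⁻ ω, (g ⁻¹' {v}).indicator Z ω ∂μ :=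
          Finset.sum_le_sum fun v _ => hsub.lintegral_mul_exp_const_le hm hη v (hind v)
      _ = ∫⁻ ω, Z ω ∂μ := by
          rw [← lintegral_finsetSum']
          · exact (lintegral_congr e2).symm
          · intro v _
            exact ((hind v).mono hm le_rfl).aemeasurable
  -- Fatou's lemma passes from simple exponents to `h`, so no dominating function is needed.
  have hs : StronglyMeasurable[m] h := hh.stronglyMeasurable
  let g : ℕ → @SimpleFunc Ω m ℝ := hs.approx
  have hg : ∀ ω, Tendsto (fun k => g k ω) atTop (𝓝 (h ω)) := hs.tendsto_approx
  have hgm : ∀ k, Measurable (g k) := fun k => (@SimpleFunc.measurable Ω ℝ m _ (g k)).mono hm le_rfl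
  have hlim : ∀ ω, Z ω * ENNReal.ofReal (Real.exp (h ω * η ω - h ω ^ 2 / 2)) =
      liminf (fun k => Z ω * ENNReal.ofReal (Real.exp (g k ω * η ω - g k ω ^ 2 / 2))) atTop := by
    intro ω
    refine (Tendsto.liminf_eq ?_).symm
    refine ENNReal.Tendsto.const_mul (ENNReal.tendsto_ofReal ?_) (Or.inl ?_)
    · exact (Real.continuous_exp.tendsto _).comp
        (((hg ω).mul_const _).sub (((hg ω).pow 2).div_const 2))
    · simp [Real.exp_pos]
  calc _ = ∫⁻ ω, liminf (fun k => Z ω *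
        ENNReal.ofReal (Real.exp (g k ω * η ω - g k ω ^ 2 / 2))) atTop ∂μ := lintegral_congr hlim
    _ ≤ liminf (fun k => ∫⁻ ω, Z ω *
        ENNReal.ofReal (Real.exp (g k ω * η ω - g k ω ^ 2 / 2)) ∂μ) atTop := by
        refine lintegral_liminf_le fun k => hZ'.mul ?_
        have := hgm k
        fun_prop
    _ ≤ ∫⁻ ω, Z ω ∂μ := by
        refine liminf_le_of_le (by isBoundedDefault) fun b hb => ?_
        obtain ⟨k, hk⟩ := hb.exists
        exact hk.trans (simple (g k))

/-- Integral of the exponential weight against a Gaussian of mean `a` and variance `w`. -/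
noncomputable def gaussianMix (a w x : ℝ) : ℝ :=
  Real.exp ((2 * a * x + w * x ^ 2 - a ^ 2) / (2 * (1 + w))) / √(1 + w)

/-- Completing the square: the integrand times the standard normal density is a constant times the
normal density of variance `(1 + w)⁻¹`. Writing the exponent as `a + √w * g` also covers the
degenerate case `w = 0`. -/
lemma lintegral_gaussian_exp_eq (a x : ℝ) {w : ℝ} (hw : 0 ≤ w) :
    ∫⁻ g, ENNReal.ofReal (Real.exp ((a + √w * g) * x - (a + √w * g) ^ 2 / 2))
      ∂(gaussianReal 0 1) = ENNReal.ofReal (gaussianMix a w x) := by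
  have hw1 : 0 < 1 + w := by linarith
  let v : ℝ≥0 := ⟨(1 + w)⁻¹, by positivity⟩
  have hvc : (v : ℝ) = (1 + w)⁻¹ := rfl
  have hv : v ≠ 0 := by
    rw [← NNReal.coe_ne_zero, hvc]; positivity
  have hsq : √w ^ 2 = w := Real.sq_sqrt hw
  rw [gaussianReal_of_var_ne_zero _ one_ne_zero,
    lintegral_withDensity_eq_lintegral_mul _ (measurable_gaussianPDF _ _) (by fun_prop)]
  calc _ = ∫⁻ g, ENNReal.ofReal (gaussianMix a w x) *
        gaussianPDF (√w * (x - a) / (1 + w)) v g := by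
        refine lintegral_congr fun g => ?_
        simp only [Pi.mul_apply, gaussianPDF]
        rw [← ENNReal.ofReal_mul (gaussianPDFReal_nonneg _ _ _),
          ← ENNReal.ofReal_mul (by unfold gaussianMix; positivity)]
        congr 1
        simp only [gaussianPDFReal, gaussianMix, hvc, NNReal.coe_one, mul_one, sub_zero]
        have h1 : √(2 * Real.pi * (1 + w)⁻¹) = √(2 * Real.pi) / √(1 + w) := by
          rw [← div_eq_mul_inv, Real.sqrt_div (by positivity)]
        rw [h1, mul_assoc, ← Real.exp_add]
        have h2 : ∀ A B : ℝ, A / √(1 + w) * ((√(2 * Real.pi) / √(1 + w))⁻¹ * B) =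
            (√(2 * Real.pi))⁻¹ * (A * B) := by
          intro A B
          have : √(1 + w) ≠ 0 := by positivity
          field_simp
        rw [h2, ← Real.exp_add]
        congr 2
        obtain ⟨r, hr⟩ : ∃ r, r = √w := ⟨_, rfl⟩
        rw [← hr] at hsq ⊢
        rw [← hsq] at hw1 ⊢
        field_simp
        ring
    _ = _ := by
        rw [lintegral_const_mul _ (measurable_gaussianPDF _ _), lintegral_gaussianPDF_eq_one _ hv,
          mul_one]

/-- One step of the method of mixtures: the Gaussian mixture keeps the integral bounded. -/
lemma CondSubGaussian.lintegral_mul_gaussianMix_le {Ω : Type*} {m mΩ : MeasurableSpace Ω}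
    {μ : Measure Ω} [IsFiniteMeasure μ] (hm : m ≤ mΩ) {η : Ω → ℝ} (hη : Measurable η)
    (hsub : CondSubGaussian μ m η 1) {a w : Ω → ℝ} (ha : Measurable[m] a) (hw : Measurable[m] w)
    (hw0 : ∀ ω, 0 ≤ w ω) {Z : Ω → ℝ≥0∞} (hZ : Measurable[m] Z) :
    ∫⁻ ω, Z ω * ENNReal.ofReal (gaussianMix (a ω) (w ω) (η ω)) ∂μ ≤ ∫⁻ ω, Z ω ∂μ := by
  have hZ' : Measurable Z := hZ.mono hm le_rfl
  have ha' : Measurable a := ha.mono hm le_rfl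
  have hw' : Measurable w := hw.mono hm le_rfl
  calc _ = ∫⁻ ω, ∫⁻ g, Z ω * ENNReal.ofReal (Real.exp ((a ω + √(w ω) * g) * η ω -
          (a ω + √(w ω) * g) ^ 2 / 2)) ∂(gaussianReal 0 1) ∂μ := by
        refine lintegral_congr fun ω => ?_
        rw [lintegral_const_mul _ (by fun_prop), lintegral_gaussian_exp_eq _ _ (hw0 ω)]
    -- After Tonelli, `g` is fixed and `a + √w * g` is an `m`-measurable exponent.
    _ = ∫⁻ g, ∫⁻ ω, Z ω * ENNReal.ofReal (Real.exp ((a ω + √(w ω) * g) * η ω -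
          (a ω + √(w ω) * g) ^ 2 / 2)) ∂μ ∂(gaussianReal 0 1) := by
        refine lintegral_lintegral_swap (Measurable.aemeasurable ?_)
        simp only [Function.uncurry_def]
        fun_prop
    _ ≤ ∫⁻ _, (∫⁻ ω, Z ω ∂μ) ∂(gaussianReal 0 1) := by
        refine lintegral_mono fun g => hsub.lintegral_mul_exp_le hm hη ?_ hZ
        exact ha.add ((Real.continuous_sqrt.measurable.comp hw).mul_const g)
    _ = _ := by simp

/-- Ville's inequality for a nonnegative process that decreases in mean on the event that the
level has not been reached. -/
lemma ville_le {Ω : Type*} {mΩ : MeasurableSpace Ω} {μ : Measure Ω}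
    {M : ℕ → Ω → ℝ≥0∞} (hM : ∀ T, Measurable (M T)) (a : ℝ≥0∞)
    (h0 : ∫⁻ ω, M 0 ω ∂μ ≤ 1)
    (hstep : ∀ T, ∫⁻ ω in {ω | ∀ s ≤ T, M s ω < a}, M (T + 1) ω ∂μ ≤
      ∫⁻ ω in {ω | ∀ s ≤ T, M s ω < a}, M T ω ∂μ) :
    a * μ {ω | ∃ T, a ≤ M T ω} ≤ 1 := by
  set A : ℕ → Set Ω := fun T => {ω | ∀ s ≤ T, M s ω < a} with hA
  have hAm : ∀ T, MeasurableSet (A T) := by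
    intro T
    simp only [hA, Set.ofPred_forall]
    exact MeasurableSet.iInter fun s => MeasurableSet.iInter fun _ =>
      measurableSet_lt (hM s) measurable_const
  have hAsucc : ∀ T, A (T + 1) ⊆ A T := fun T ω h s hs => h s (hs.trans (Nat.le_succ T))
  -- The invariant charges `a` on paths that have reached the level and keeps the current value on
  -- the others.
  have main : ∀ T, a * μ (A T)ᶜ + ∫⁻ ω in A T, M T ω ∂μ ≤ 1 := by
    intro T
    induction T with
    | zero =>
      refine le_trans ?_ h0
      rw [← lintegral_add_compl (μ := μ) (M 0) (hAm 0), add_comm (a * _)]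
      refine add_le_add le_rfl ?_
      rw [← setLIntegral_const]
      refine setLIntegral_mono (hM 0) fun ω hω => ?_
      simpa [hA] using hω
    | succ T ih =>
      refine le_trans ?_ ih
      have hsplit : (A (T + 1))ᶜ = (A T)ᶜ ∪ (A T \ A (T + 1)) := by
        ext ω
        have := @hAsucc T ω
        simp only [Set.mem_compl_iff, Set.mem_union, Set.mem_sdiff]
        tauto
      -- On this set the level is first reached at time `T + 1`.
      have hge : a * μ (A T \ A (T + 1)) ≤ ∫⁻ ω in A T \ A (T + 1), M (T + 1) ω ∂μ := by
        rw [← setLIntegral_const]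
        refine setLIntegral_mono (hM _) fun ω hω => ?_
        by_contra hlt
        refine hω.2 fun s hs => ?_
        rcases Nat.lt_or_ge T s with h | h
        · obtain rfl : s = T + 1 := by omega
          exact not_le.1 hlt
        · exact hω.1 s h
      have hint : ∫⁻ ω in A (T + 1), M (T + 1) ω ∂μ + ∫⁻ ω in A T \ A (T + 1), M (T + 1) ω ∂μ =
          ∫⁻ ω in A T, M (T + 1) ω ∂μ := by
        rw [← lintegral_inter_add_sdiff (M (T + 1)) (A T) (hAm (T + 1)),
          Set.inter_eq_self_of_subset_right (hAsucc T)]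
      calc _ ≤ a * (μ (A T)ᶜ + μ (A T \ A (T + 1))) + ∫⁻ ω in A (T + 1), M (T + 1) ω ∂μ := by
            rw [hsplit]; gcongr; exact measure_union_le _ _
        _ = a * μ (A T)ᶜ + (∫⁻ ω in A (T + 1), M (T + 1) ω ∂μ + a * μ (A T \ A (T + 1))) := by
            ring
        _ ≤ a * μ (A T)ᶜ + ∫⁻ ω in A T, M (T + 1) ω ∂μ := by
            rw [← hint]; gcongr
        _ ≤ _ := add_le_add le_rfl (hstep T)
  have hun : {ω | ∃ T, a ≤ M T ω} = ⋃ T, (A T)ᶜ := by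
    ext ω
    simp only [hA, Set.mem_ofPred_eq, Set.mem_iUnion, Set.mem_compl_iff, not_forall, not_lt]
    exact ⟨fun ⟨T, h⟩ => ⟨T, T, le_rfl, h⟩, fun ⟨_, s, _, h⟩ => ⟨s, h⟩⟩
  have hmono : Monotone fun T => (A T)ᶜ :=
    monotone_nat_of_le_succ fun T => Set.compl_subset_compl.2 (hAsucc T)
  rw [hun, hmono.measure_iUnion, ENNReal.mul_iSup]
  exact iSup_le fun T => le_self_add.trans (main T)

end ClientSelection

namespace ClientSelection
-- Gram matrices under rank-one updates, and the mixture process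
section LinearAlgebra

open Matrix

variable {ι : Type*} [Fintype ι]

lemma dotProduct_mulVec_comm {A : Matrix ι ι ℝ} (hA : A.IsHermitian) (u v : ι → ℝ) :
    u ⬝ᵥ (A *ᵥ v) = v ⬝ᵥ (A *ᵥ u) := by
  have hT : Aᵀ = A := by simpa [conjTranspose_eq_transpose_of_trivial] using hA.eq
  rw [dotProduct_mulVec, ← mulVec_transpose, hT, dotProduct_comm]

/-- Cauchy–Schwarz for the form of a positive semidefinite matrix. -/
lemma sq_dotProduct_mulVec_le {A : Matrix ι ι ℝ} (hA : A.PosSemidef) (u v : ι → ℝ) :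
    (u ⬝ᵥ (A *ᵥ v)) ^ 2 ≤ (u ⬝ᵥ (A *ᵥ u)) * (v ⬝ᵥ (A *ᵥ v)) := by
  have h : ∀ t : ℝ, 0 ≤ (v ⬝ᵥ (A *ᵥ v)) * (t * t) + (2 * (u ⬝ᵥ (A *ᵥ v))) * t +
      u ⬝ᵥ (A *ᵥ u) := by
    intro t
    have h0 := hA.dotProduct_mulVec_nonneg (u + t • v)
    simp only [star_trivial, mulVec_add, mulVec_smul, add_dotProduct, dotProduct_add,
      smul_dotProduct, dotProduct_smul, smul_eq_mul] at h0
    rw [dotProduct_mulVec_comm hA.1 v u] at h0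
    linarith
  have := discrim_le_zero h
  rw [discrim] at this
  nlinarith

lemma sq_dotProduct_le (u v : ι → ℝ) : (u ⬝ᵥ v) ^ 2 ≤ (u ⬝ᵥ u) * (v ⬝ᵥ v) := by
  classical
  simpa using sq_dotProduct_mulVec_le (A := (1 : Matrix ι ι ℝ)) PosSemidef.one u v

lemma dotProduct_self_nonneg_real (u : ι → ℝ) : 0 ≤ u ⬝ᵥ u := by
  simpa [dotProduct] using Finset.sum_nonneg fun i (_ : i ∈ Finset.univ) => mul_self_nonneg (u i)

variable [DecidableEq ι]

/-- The regularised Gram matrix of the vectors `y 1, …, y T`. -/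
noncomputable def regGram (lam : ℝ) (y : ℕ → ι → ℝ) (T : ℕ) : Matrix ι ι ℝ :=
  lam • (1 : Matrix ι ι ℝ) + ∑ s ∈ Finset.Icc 1 T, vecMulVec (y s) (y s)

/-- The noise accumulated along the vectors `y 1, …, y T`. -/
noncomputable def noiseSum (y : ℕ → ι → ℝ) (η : ℕ → ℝ) (T : ℕ) : ι → ℝ :=
  ∑ s ∈ Finset.Icc 1 T, η s • y s

lemma regGram_zero {κ : Type*} [DecidableEq κ] (lam : ℝ) (y : ℕ → κ → ℝ) : regGram lam y 0 = lam • 1 := by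
  simp [regGram]

lemma regGram_succ {κ : Type*} [DecidableEq κ] (lam : ℝ) (y : ℕ → κ → ℝ) (T : ℕ) :
    regGram lam y (T + 1) = regGram lam y T + vecMulVec (y (T + 1)) (y (T + 1)) := by
  rw [regGram, regGram, Finset.sum_Icc_succ_top (by omega), add_assoc]

lemma noiseSum_succ {κ : Type*} (y : ℕ → κ → ℝ) (η : ℕ → ℝ) (T : ℕ) :
    noiseSum y η (T + 1) = noiseSum y η T + η (T + 1) • y (T + 1) := by
  rw [noiseSum, noiseSum, Finset.sum_Icc_succ_top (by omega)]

lemma posDef_regGram {lam : ℝ} (hlam : 0 < lam) (y : ℕ → ι → ℝ) (T : ℕ) :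
    (regGram lam y T).PosDef := by
  refine (PosDef.smul PosDef.one hlam).add_posSemidef (posSemidef_sum _ fun s _ => ?_)
  simpa using posSemidef_vecMulVec_self_star (y s)

lemma dotProduct_regGram_mulVec (lam : ℝ) (y : ℕ → ι → ℝ) (T : ℕ) (v : ι → ℝ) :
    v ⬝ᵥ (regGram lam y T *ᵥ v) = lam * (v ⬝ᵥ v) + ∑ s ∈ Finset.Icc 1 T, (y s ⬝ᵥ v) ^ 2 := by
  simp only [regGram, add_mulVec, smul_mulVec, one_mulVec, sum_mulVec, dotProduct_add,
    dotProduct_smul, dotProduct_sum, vecMulVec_mulVec, smul_eq_mul, op_smul_eq_smul]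
  congr 1
  refine Finset.sum_congr rfl fun s _ => ?_
  rw [dotProduct_comm v (y s)]; ring

/-- A lower bound for the form of `H` is an upper bound for the form of its inverse. -/
lemma mul_dotProduct_inv_mulVec_le {H : Matrix ι ι ℝ} (hH : H.PosDef) {lam : ℝ} (hlam : 0 < lam)
    (hle : ∀ v, lam * (v ⬝ᵥ v) ≤ v ⬝ᵥ (H *ᵥ v)) (u : ι → ℝ) :
    lam * (u ⬝ᵥ (H⁻¹ *ᵥ u)) ≤ u ⬝ᵥ u := by
  set z := H⁻¹ *ᵥ u with hz
  have hHz : H *ᵥ z = u := by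
    rw [hz, mulVec_mulVec, mul_nonsing_inv _ ((isUnit_iff_isUnit_det _).1 hH.isUnit), one_mulVec]
  have h1 := hle z
  rw [hHz, dotProduct_comm] at h1
  have h2 := sq_dotProduct_le u z
  have h3 := dotProduct_self_nonneg_real z
  have h4 := dotProduct_self_nonneg_real u
  have h1' : lam * (z ⬝ᵥ z) ≤ u ⬝ᵥ z := by rw [dotProduct_comm] at h1; linarith [dotProduct_comm u z]
  rcases le_or_gt (u ⬝ᵥ z) 0 with h | h
  · nlinarith
  -- Cauchy–Schwarz times `lam` gives `lam (u·z)² ≤ |u|² (lam |z|²) ≤ |u|² (u·z)`; one factor `u·z`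
  -- cancels.
  · have : (u ⬝ᵥ z) * (lam * (u ⬝ᵥ z)) ≤ (u ⬝ᵥ z) * (u ⬝ᵥ u) := by nlinarith
    exact le_of_mul_le_mul_left this h

/-- The matrix determinant lemma for a rank-one update. -/
lemma det_add_vecMulVec_self {H : Matrix ι ι ℝ} (hH : IsUnit H.det) (y : ι → ℝ) :
    (H + vecMulVec y y).det = H.det * (1 + y ⬝ᵥ (H⁻¹ *ᵥ y)) := by
  rw [vecMulVec_eq Unit, det_add_replicateCol_mul_replicateRow hH,
    det_unique (n := Unit), Matrix.add_apply, one_apply_eq, Matrix.mul_assoc,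
    ← replicateCol_mulVec, replicateRow_mul_replicateCol_apply]

/-- The inverse form after a rank-one update, at an updated vector. -/
lemma dotProduct_inv_add_vecMulVec {H : Matrix ι ι ℝ} (hH : H.PosDef) (y S : ι → ℝ) (x : ℝ) :
    (S + x • y) ⬝ᵥ ((H + vecMulVec y y)⁻¹ *ᵥ (S + x • y)) = S ⬝ᵥ (H⁻¹ *ᵥ S) +
      (2 * (y ⬝ᵥ (H⁻¹ *ᵥ S)) * x + (y ⬝ᵥ (H⁻¹ *ᵥ y)) * x ^ 2 - (y ⬝ᵥ (H⁻¹ *ᵥ S)) ^ 2) /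
        (1 + y ⬝ᵥ (H⁻¹ *ᵥ y)) := by
  have hw : 0 ≤ y ⬝ᵥ (H⁻¹ *ᵥ y) := by simpa using hH.inv.posSemidef.dotProduct_mulVec_nonneg y
  have hsymm := dotProduct_mulVec_comm hH.inv.1 S y
  have hu : IsUnit H.det := (isUnit_iff_isUnit_det _).1 hH.isUnit
  have hu' : IsUnit (H + vecMulVec y y).det := by
    rw [det_add_vecMulVec_self hu]
    exact hu.mul (IsUnit.mk0 _ (by positivity))
  set w := y ⬝ᵥ (H⁻¹ *ᵥ y) with hwdef
  set a := y ⬝ᵥ (H⁻¹ *ᵥ S) with ha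
  have hw1 : 1 + w ≠ 0 := by positivity
  -- The Sherman–Morrison solution, checked by applying `H + y yᵀ` to it.
  have hz : (H + vecMulVec y y)⁻¹ *ᵥ (S + x • y) =
      H⁻¹ *ᵥ S + ((x - a) / (1 + w)) • (H⁻¹ *ᵥ y) := by
    have : (H + vecMulVec y y) *ᵥ (H⁻¹ *ᵥ S + ((x - a) / (1 + w)) • (H⁻¹ *ᵥ y)) =
        S + x • y := by
      have hk : (x - a) / (1 + w) + (a + (x - a) / (1 + w) * w) = x := by field_simp; ring
      rw [add_mulVec, vecMulVec_mulVec, mulVec_add, mulVec_smul, mulVec_mulVec, mulVec_mulVec,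
        mul_nonsing_inv _ hu, one_mulVec, one_mulVec, dotProduct_add, dotProduct_smul, ← hwdef,
        ← ha, op_smul_eq_smul, add_assoc, ← add_smul, smul_eq_mul, hk]
    rw [← this, mulVec_mulVec, nonsing_inv_mul _ hu', one_mulVec]
  rw [hz]
  simp only [add_dotProduct, dotProduct_add, smul_dotProduct, dotProduct_smul, smul_eq_mul, hsymm,
    ← hwdef, ← ha]
  field_simp
  ring

/-- The determinant is at most the power of an upper bound for the form. -/
lemma det_le_pow {H : Matrix ι ι ℝ} (hH : H.PosDef) {C : ℝ}
    (hle : ∀ v, v ⬝ᵥ (H *ᵥ v) ≤ C * (v ⬝ᵥ v)) : H.det ≤ C ^ Fintype.card ι := by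
  have hev : ∀ i, hH.1.eigenvalues i ≤ C := by
    intro i
    rw [hH.1.eigenvalues_eq i]
    have h1 := hle (hH.1.eigenvectorBasis i).ofLp
    have h2 : (hH.1.eigenvectorBasis i).ofLp ⬝ᵥ (hH.1.eigenvectorBasis i).ofLp = 1 := by
      have := hH.1.eigenvectorBasis.orthonormal.1 i
      have h3 := EuclideanSpace.real_norm_sq_eq (hH.1.eigenvectorBasis i)
      rw [this] at h3
      simp only [dotProduct, ← sq]
      linarith
    rw [h2] at h1
    simpa using h1
  rw [hH.1.det_eq_prod_eigenvalues]
  calc _ ≤ ∏ _i : ι, C :=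
        Finset.prod_le_prod (fun i _ => (hH.eigenvalues_pos i).le) fun i _ => hev i
    _ = _ := by simp

/-- Cauchy–Schwarz bounds the form by `(lam + T L²) |v|²`. The sharper trace bound, with `L² / d`,
is not needed for `explorationParam`. -/
lemma det_regGram_le {lam : ℝ} (hlam : 0 < lam) {L : ℝ} (y : ℕ → ι → ℝ) (T : ℕ)
    (hy : ∀ s, 1 ≤ s → y s ⬝ᵥ y s ≤ L ^ 2) :
    (regGram lam y T).det ≤ (lam + T * L ^ 2) ^ Fintype.card ι := by
  refine det_le_pow (posDef_regGram hlam y T) fun v => ?_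
  rw [dotProduct_regGram_mulVec, add_mul]
  gcongr
  calc _ ≤ ∑ s ∈ Finset.Icc 1 T, L ^ 2 * (v ⬝ᵥ v) := by
        refine Finset.sum_le_sum fun s hs => (sq_dotProduct_le _ _).trans ?_
        exact mul_le_mul_of_nonneg_right (hy s (Finset.mem_Icc.1 hs).1)
          (dotProduct_self_nonneg_real v)
    _ = _ := by simp; ring

/-- The mixture process of the self-normalised bound. -/
noncomputable def mixtureProcess (lam : ℝ) (y : ℕ → ι → ℝ) (η : ℕ → ℝ) (T : ℕ) : ℝ :=
  Real.exp (noiseSum y η T ⬝ᵥ ((regGram lam y T)⁻¹ *ᵥ noiseSum y η T) / 2) *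
    √(lam ^ Fintype.card ι / (regGram lam y T).det)

lemma mixtureProcess_zero {lam : ℝ} (hlam : 0 < lam) (y : ℕ → ι → ℝ) (η : ℕ → ℝ) :
    mixtureProcess lam y η 0 = 1 := by
  have : lam ^ Fintype.card ι ≠ 0 := by positivity
  simp [mixtureProcess, regGram_zero, noiseSum, div_self this]

/-- The rank-one change of the inverse form supplies the exponent of `gaussianMix` and the
determinant lemma its factor `√(1 + w)`. Here `a` and `w` are the mean and variance of `yᵀ u` for
`u` Gaussian with mean `H⁻¹ S` and covariance `H⁻¹`. -/
lemma mixtureProcess_succ {lam : ℝ} (hlam : 0 < lam) (y : ℕ → ι → ℝ) (η : ℕ → ℝ) (T : ℕ) :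
    mixtureProcess lam y η (T + 1) = mixtureProcess lam y η T *
      gaussianMix (y (T + 1) ⬝ᵥ ((regGram lam y T)⁻¹ *ᵥ noiseSum y η T))
        (y (T + 1) ⬝ᵥ ((regGram lam y T)⁻¹ *ᵥ y (T + 1))) (η (T + 1)) := by
  have hH := posDef_regGram hlam y T
  have hw : 0 ≤ y (T + 1) ⬝ᵥ ((regGram lam y T)⁻¹ *ᵥ y (T + 1)) := by
    simpa using hH.inv.posSemidef.dotProduct_mulVec_nonneg (y (T + 1))
  rw [mixtureProcess, mixtureProcess, regGram_succ, noiseSum_succ,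
    dotProduct_inv_add_vecMulVec hH,
    det_add_vecMulVec_self ((isUnit_iff_isUnit_det _).1 hH.isUnit), gaussianMix, add_div,
    Real.exp_add, ← div_div (lam ^ Fintype.card ι), Real.sqrt_div' _ (by positivity), div_div,
    mul_comm (1 + _) (2 : ℝ)]
  ring

end LinearAlgebra

/-! ### Measurability of the matrix expressions -/

section Measurability

variable {Ω : Type*} {m : MeasurableSpace Ω} {ι : Type*} [Fintype ι] [DecidableEq ι]

lemma measurable_matrix_det {A : Ω → Matrix ι ι ℝ} (hA : ∀ i j, Measurable fun ω => A ω i j) :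
    Measurable fun ω => (A ω).det := by
  simp only [Matrix.det_apply]
  exact Finset.measurable_sum _ fun σ _ =>
    (Finset.measurable_prod _ fun i _ => hA _ _).const_smul _

/-- By the adjugate formula the entries are quotients of determinants; singular matrices need no
care, since inversion on `ℝ` is measurable with `0⁻¹ = 0`. -/
lemma measurable_matrix_inv {A : Ω → Matrix ι ι ℝ} (hA : ∀ i j, Measurable fun ω => A ω i j)
    (i j : ι) : Measurable fun ω => (A ω)⁻¹ i j := by
  simp only [Matrix.inv_def, Matrix.smul_apply, smul_eq_mul, Ring.inverse_eq_inv',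
    Matrix.adjugate_apply]
  refine (measurable_matrix_det hA).inv.mul (measurable_matrix_det fun k l => ?_)
  by_cases h : k = j
  · subst h; simp
  · simpa [Matrix.updateRow_ne h] using hA k l

lemma measurable_dotProduct_mulVec {κ : Type*} [Fintype κ] {A : Ω → Matrix κ κ ℝ}
    {u v : Ω → κ → ℝ}
    (hA : ∀ i j, Measurable fun ω => A ω i j) (hu : ∀ i, Measurable fun ω => u ω i)
    (hv : ∀ i, Measurable fun ω => v ω i) :
    Measurable fun ω => u ω ⬝ᵥ (A ω *ᵥ v ω) := by
  simp only [Matrix.mulVec, dotProduct]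
  exact Finset.measurable_sum _ fun i _ =>
    (hu i).mul (Finset.measurable_sum _ fun j _ => (hA i j).mul (hv j))

lemma measurable_regGram {κ : Type*} [DecidableEq κ] (lam : ℝ) {y : ℕ → Ω → κ → ℝ} {T : ℕ}
    (hy : ∀ s, 1 ≤ s → s ≤ T → ∀ i, Measurable fun ω => y s ω i) (i j : κ) :
    Measurable fun ω => regGram lam (fun s => y s ω) T i j := by
  simp only [regGram, Matrix.add_apply, Matrix.sum_apply, Matrix.vecMulVec_apply]
  refine measurable_const.add (Finset.measurable_sum _ fun s hs => ?_)
  obtain ⟨h1, h2⟩ := Finset.mem_Icc.1 hs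
  exact (hy s h1 h2 i).mul (hy s h1 h2 j)

lemma measurable_noiseSum {κ : Type*} {y : ℕ → Ω → κ → ℝ} {η : ℕ → Ω → ℝ} {T : ℕ}
    (hy : ∀ s, 1 ≤ s → s ≤ T → ∀ i, Measurable fun ω => y s ω i)
    (hη : ∀ s, 1 ≤ s → s ≤ T → Measurable (η s)) (i : κ) :
    Measurable fun ω => noiseSum (fun s => y s ω) (fun s => η s ω) T i := by
  simp only [noiseSum, Finset.sum_apply, Pi.smul_apply, smul_eq_mul]
  refine Finset.measurable_sum _ fun s hs => ?_
  obtain ⟨h1, h2⟩ := Finset.mem_Icc.1 hs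
  exact (hη s h1 h2).mul (hy s h1 h2 i)

lemma measurable_mixtureProcess (lam : ℝ) {y : ℕ → Ω → ι → ℝ} {η : ℕ → Ω → ℝ} {T : ℕ}
    (hy : ∀ s, 1 ≤ s → s ≤ T → ∀ i, Measurable fun ω => y s ω i)
    (hη : ∀ s, 1 ≤ s → s ≤ T → Measurable (η s)) :
    Measurable fun ω => mixtureProcess lam (fun s => y s ω) (fun s => η s ω) T := by
  have hG := measurable_regGram lam hy
  have hS := measurable_noiseSum hy hη
  have h1 := measurable_dotProduct_mulVec (measurable_matrix_inv hG) hS hS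
  have h2 := measurable_matrix_det hG
  unfold mixtureProcess
  exact (h1.div_const 2).exp.mul (h2.const_div _).sqrt

end Measurability

/-! ### The self-normalised tail bound -/

open scoped ENNReal in
/-- The self-normalised tail bound, in terms of the mixture process. -/
theorem measure_exists_le_mixtureProcess {Ω : Type*} {mΩ : MeasurableSpace Ω} {μ : Measure Ω}
    [IsProbabilityMeasure μ] {ι : Type*} [Fintype ι] [DecidableEq ι] {lam δ : ℝ} (hlam : 0 < lam)
    (hδ : 0 < δ) {m : ℕ → MeasurableSpace Ω} (hm : ∀ t, 1 ≤ t → m t ≤ mΩ)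
    {y : ℕ → Ω → ι → ℝ} {η : ℕ → Ω → ℝ}
    (hy : ∀ s t, 1 ≤ s → s ≤ t → ∀ i, Measurable[m t] fun ω => y s ω i)
    (hη : ∀ s t, 1 ≤ s → s < t → Measurable[m t] (η s))
    (hsub : ∀ t, 1 ≤ t → CondSubGaussian μ (m t) (η t) 1) :
    μ {ω | ∃ T, 1 / δ ≤ mixtureProcess lam (fun s => y s ω) (fun s => η s ω) T} ≤
      ENNReal.ofReal δ := by
  set M : ℕ → Ω → ℝ := fun T ω => mixtureProcess lam (fun s => y s ω) (fun s => η s ω) T with hMdef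
  -- The index is `T + 1` because `m (T + 1)` describes the time just before the noise of round `T +
  -- 1`. Monotonicity of `m` is not assumed; `hy` and `hη` speak of all later rounds directly.
  have hMm : ∀ s T, s ≤ T → Measurable[m (T + 1)] (M s) := fun s T hsT =>
    measurable_mixtureProcess (m := m (T + 1)) lam
      (fun r h1 h2 => hy r (T + 1) h1 (by omega)) (fun r h1 h2 => hη r (T + 1) h1 (by omega))
  have hMm' : ∀ T, Measurable (M T) := fun T => (hMm T T le_rfl).mono (hm _ (by omega)) le_rfl
  have hM0 : ∀ T ω, 0 ≤ M T ω := fun T ω => by simp only [hMdef, mixtureProcess]; positivity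
  have hville := ville_le (μ := μ) (M := fun T ω => ENNReal.ofReal (M T ω))
    (fun T => (hMm' T).ennreal_ofReal) (ENNReal.ofReal (1 / δ)) (by
      simp [hMdef, mixtureProcess_zero hlam]) (by
      intro T
      -- The event of not having reached the level is known before the next noise, so its indicator
      -- can be part of the weight `Z`.
      have hAm : MeasurableSet[m (T + 1)]
          {ω | ∀ s ≤ T, ENNReal.ofReal (M s ω) < ENNReal.ofReal (1 / δ)} := by
        simp only [Set.ofPred_forall]
        exact MeasurableSet.iInter fun s => MeasurableSet.iInter fun hs =>
          measurableSet_lt (mδ := m (T + 1)) (hMm s T hs).ennreal_ofReal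
            measurable_const
      rw [← lintegral_indicator (hm _ (by omega) _ hAm),
        ← lintegral_indicator (hm _ (by omega) _ hAm)]
      refine le_trans (le_of_eq ?_) ((hsub (T + 1) (by omega)).lintegral_mul_gaussianMix_le
        (hm _ (by omega)) ((hη (T + 1) (T + 2) (by omega) (by omega)).mono (hm _ (by omega)) le_rfl)
        (a := fun ω => y (T + 1) ω ⬝ᵥ ((regGram lam (fun s => y s ω) T)⁻¹ *ᵥ
          noiseSum (fun s => y s ω) (fun s => η s ω) T))
        (w := fun ω => y (T + 1) ω ⬝ᵥ ((regGram lam (fun s => y s ω) T)⁻¹ *ᵥ y (T + 1) ω))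
        ?_ ?_ ?_ ((hMm T T le_rfl).ennreal_ofReal.indicator hAm))
      · refine lintegral_congr fun ω => ?_
        by_cases hω : ω ∈ {ω | ∀ s ≤ T, ENNReal.ofReal (M s ω) < ENNReal.ofReal (1 / δ)}
        · rw [Set.indicator_of_mem hω, Set.indicator_of_mem hω, ← ENNReal.ofReal_mul (hM0 T ω)]
          simp only [hMdef]
          rw [mixtureProcess_succ hlam]
        · rw [Set.indicator_of_notMem hω, Set.indicator_of_notMem hω, zero_mul]
      · exact measurable_dotProduct_mulVec (m := m (T + 1))
          (measurable_matrix_inv (m := m (T + 1)) (measurable_regGram (m := m (T + 1)) lam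
            fun r h1 h2 => hy r (T + 1) h1 (by omega)))
          (hy (T + 1) (T + 1) (by omega) le_rfl)
          (measurable_noiseSum (m := m (T + 1)) (fun r h1 h2 => hy r (T + 1) h1 (by omega))
            fun r h1 h2 => hη r (T + 1) h1 (by omega))
      · exact measurable_dotProduct_mulVec (m := m (T + 1))
          (measurable_matrix_inv (m := m (T + 1)) (measurable_regGram (m := m (T + 1)) lam
            fun r h1 h2 => hy r (T + 1) h1 (by omega)))
          (hy (T + 1) (T + 1) (by omega) le_rfl) (hy (T + 1) (T + 1) (by omega) le_rfl)
      · intro ω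
        simpa using (posDef_regGram hlam (fun s => y s ω) T).inv.posSemidef.dotProduct_mulVec_nonneg
          (y (T + 1) ω))
  have hset : {ω | ∃ T, 1 / δ ≤ M T ω} =
      {ω | ∃ T, ENNReal.ofReal (1 / δ) ≤ ENNReal.ofReal (M T ω)} := by
    ext ω
    exact exists_congr fun T => (ENNReal.ofReal_le_ofReal_iff (hM0 T ω)).symm
  rw [hset]
  have hd : ENNReal.ofReal δ * ENNReal.ofReal (1 / δ) = 1 := by
    rw [← ENNReal.ofReal_mul hδ.le, mul_one_div_cancel hδ.ne', ENNReal.ofReal_one]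
  calc _ = ENNReal.ofReal δ * (ENNReal.ofReal (1 / δ) *
        μ {ω | ∃ T, ENNReal.ofReal (1 / δ) ≤ ENNReal.ofReal (M T ω)}) := by
        rw [← mul_assoc, hd, one_mul]
    _ ≤ ENNReal.ofReal δ * 1 := by gcongr
    _ = _ := mul_one _

end ClientSelection

namespace ClientSelection

/-! ### Sub-Gaussian noise: integrability, scaling, the case `R = 0` -/

section SubGaussian

variable {Ω : Type*} {m mΩ : MeasurableSpace Ω} {μ : Measure Ω} {X : Ω → ℝ} {R : ℝ}

/-- Domination by `|x| ≤ exp x + exp (-x)`. -/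
lemma CondSubGaussian.integrable (h : CondSubGaussian μ m X R) (hX : Measurable X) :
    Integrable X μ := by
  refine ((h 1).1.add (h (-1)).1).mono' hX.aestronglyMeasurable (ae_of_all _ fun ω => ?_)
  simp only [Pi.add_apply, one_mul, neg_one_mul, Real.norm_eq_abs]
  have h1 := Real.add_one_le_exp (X ω)
  have h2 := Real.add_one_le_exp (-X ω)
  have h3 := Real.exp_pos (X ω)
  have h4 := Real.exp_pos (-X ω)
  rcases abs_cases (X ω) with ⟨h, _⟩ | ⟨h, _⟩ <;> rw [h] <;> linarith

lemma CondSubGaussian.div_self (h : CondSubGaussian μ m X R) (hR : 0 < R) :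
    CondSubGaussian μ m (fun ω => X ω / R) 1 := by
  intro Λ
  have h1 := h (Λ / R)
  have e : ∀ ω, Λ / R * X ω = Λ * (X ω / R) := fun ω => by ring
  have e2 : (Λ / R) ^ 2 * R ^ 2 / 2 = Λ ^ 2 * 1 ^ 2 / 2 := by field_simp
  simpa only [e, e2] using h1

/-- The mean of `2 (cosh X - 1) ≥ 0` is at most `0`, and `cosh` equals `1` only at `0`. This serves
the case in which the noise cannot be divided by `R`. -/
lemma CondSubGaussian.ae_eq_zero [IsProbabilityMeasure μ] (hm : m ≤ mΩ)
    (h : CondSubGaussian μ m X 0) : ∀ᵐ ω ∂μ, X ω = 0 := by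
  have hle : ∀ Λ : ℝ, ∫ ω, Real.exp (Λ * X ω) ∂μ ≤ 1 := by
    intro Λ
    rw [← integral_condExp hm]
    calc _ ≤ ∫ _, (1 : ℝ) ∂μ := by
          refine integral_mono_ae integrable_condExp (integrable_const 1) ?_
          filter_upwards [(h Λ).2] with ω hω
          simpa using hω
      _ = 1 := by simp
  have hi : Integrable (fun ω => Real.exp (1 * X ω) + Real.exp (-1 * X ω) - 2) μ :=
    ((h 1).1.add (h (-1)).1).sub (integrable_const 2)
  have hc : ∀ ω, Real.exp (1 * X ω) + Real.exp (-1 * X ω) - 2 = 2 * (Real.cosh (X ω) - 1) := by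
    intro ω
    rw [Real.cosh_eq, one_mul, neg_one_mul]; ring
  have h0 : 0 ≤ fun ω => Real.exp (1 * X ω) + Real.exp (-1 * X ω) - 2 := by
    intro ω
    simp only [hc, Pi.zero_apply]
    linarith [Real.one_le_cosh (X ω)]
  have hz : ∫ ω, (Real.exp (1 * X ω) + Real.exp (-1 * X ω) - 2) ∂μ = 0 := by
    refine le_antisymm ?_ (integral_nonneg h0)
    have hadd : Integrable (fun ω => Real.exp (1 * X ω) + Real.exp (-1 * X ω)) μ :=
      (h 1).1.add (h (-1)).1
    rw [integral_sub hadd (integrable_const 2), integral_add (h 1).1 (h (-1)).1]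
    have := hle 1
    have := hle (-1)
    simp only [integral_const, probReal_univ, one_smul]
    linarith
  filter_upwards [(integral_eq_zero_iff_of_nonneg h0 hi).1 hz] with ω hω
  rw [hc, Pi.zero_apply] at hω
  by_contra hne
  linarith [Real.one_lt_cosh.2 hne]

end SubGaussian

/-! ### Deterministic consequences: noise bound and ridge error -/

section Deterministic

open Matrix

variable {ι : Type*} [Fintype ι] [DecidableEq ι]

/-- A value of the mixture process below `1 / δ` bounds the self-normalised noise. -/
lemma inv_form_le_of_mixtureProcess_lt {lam L δ : ℝ} (hlam : 0 < lam) (hδ : 0 < δ) (hδ1 : δ ≤ 1)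
    (hcard : 2 ≤ Fintype.card ι) {y : ℕ → ι → ℝ} {η : ℕ → ℝ} {T : ℕ}
    (hy : ∀ s, 1 ≤ s → y s ⬝ᵥ y s ≤ L ^ 2) (hM : mixtureProcess lam y η T < 1 / δ) :
    noiseSum y η T ⬝ᵥ ((regGram lam y T)⁻¹ *ᵥ noiseSum y η T) ≤
      Fintype.card ι * Real.log ((1 + T * L ^ 2 / lam) / δ) := by
  set q := noiseSum y η T ⬝ᵥ ((regGram lam y T)⁻¹ *ᵥ noiseSum y η T) with hq
  set d := Fintype.card ι
  set B := 1 + T * L ^ 2 / lam with hB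
  have hB0 : 0 < B := by positivity
  have hdet0 := (posDef_regGram hlam y T).det_pos
  have hdet : (regGram lam y T).det ≤ lam ^ d * B ^ d := by
    have h := det_regGram_le hlam y T hy
    rwa [← mul_pow, show lam * B = lam + T * L ^ 2 by rw [hB]; field_simp]
  have hr : (B ^ d)⁻¹ ≤ lam ^ d / (regGram lam y T).det := by
    rw [inv_eq_one_div, div_le_div_iff₀ (by positivity) hdet0, one_mul]
    exact hdet
  have h1 : Real.exp q * (B ^ d)⁻¹ ≤ (1 / δ) ^ 2 := by
    have h2 : mixtureProcess lam y η T ^ 2 =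
        Real.exp q * (lam ^ d / (regGram lam y T).det) := by
      rw [mixtureProcess, mul_pow, Real.sq_sqrt (by positivity), ← Real.exp_nat_mul, ← hq]
      congr 2
      push_cast; ring
    have h0 : 0 ≤ mixtureProcess lam y η T := by rw [mixtureProcess]; positivity
    calc _ ≤ Real.exp q * (lam ^ d / (regGram lam y T).det) := by gcongr
      _ = mixtureProcess lam y η T ^ 2 := h2.symm
      _ ≤ _ := by gcongr
  have h3 : Real.exp q ≤ (B / δ) ^ d := by
    rw [← div_eq_mul_inv, div_le_iff₀ (by positivity)] at h1
    calc _ ≤ (1 / δ) ^ 2 * B ^ d := h1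
      -- The exponent `2` comes from squaring away the root; raising it to `d ≥ 2`, with `1 / δ ≥
      -- 1`, puts `δ` under the same power as `B`.
      _ ≤ (1 / δ) ^ d * B ^ d := by
          gcongr
          rw [le_div_iff₀ hδ]; linarith
      _ = _ := by rw [← mul_pow]; congr 1; ring
  rw [← Real.log_pow]
  exact (Real.le_log_iff_exp_le (by positivity)).2 h3

/-- The prediction error of ridge regression in terms of the self-normalised noise. -/
lemma abs_ridge_sub_le {H : Matrix ι ι ℝ} (hH : H.PosDef) {lam β S : ℝ} (hlam : 0 < lam)
    (hβ : 0 ≤ β) (hS : 0 ≤ S) (hle : ∀ v, lam * (v ⬝ᵥ v) ≤ v ⬝ᵥ (H *ᵥ v)) {G θ : ι → ℝ}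
    (hG : G ⬝ᵥ (H⁻¹ *ᵥ G) ≤ β ^ 2) (hθ : θ ⬝ᵥ θ ≤ S ^ 2) (x : ι → ℝ) :
    |x ⬝ᵥ (H⁻¹ *ᵥ (G + (H *ᵥ θ - lam • θ))) - x ⬝ᵥ θ| ≤
      (β + √lam * S) * √(x ⬝ᵥ (H⁻¹ *ᵥ x)) := by
  have hP := hH.inv.posSemidef
  have hx : 0 ≤ x ⬝ᵥ (H⁻¹ *ᵥ x) := by simpa using hP.dotProduct_mulVec_nonneg x
  -- The error splits into a noise term and the regularisation bias `lam xᵀ H⁻¹ θ`. Each is bounded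
  -- by Cauchy–Schwarz for `H⁻¹`, the bias also by `lam θᵀ H⁻¹ θ ≤ |θ|²`.
  have hb : x ⬝ᵥ (H⁻¹ *ᵥ (G + (H *ᵥ θ - lam • θ))) - x ⬝ᵥ θ =
      x ⬝ᵥ (H⁻¹ *ᵥ G) - lam * (x ⬝ᵥ (H⁻¹ *ᵥ θ)) := by
    rw [mulVec_add, mulVec_sub, mulVec_smul, mulVec_mulVec,
      nonsing_inv_mul _ ((isUnit_iff_isUnit_det _).1 hH.isUnit), one_mulVec]
    simp only [dotProduct_add, dotProduct_sub, dotProduct_smul, smul_eq_mul]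
    ring
  have h1 : |x ⬝ᵥ (H⁻¹ *ᵥ G)| ≤ β * √(x ⬝ᵥ (H⁻¹ *ᵥ x)) := by
    refine abs_le_of_sq_le_sq ?_ (by positivity)
    rw [mul_pow, Real.sq_sqrt hx]
    calc _ ≤ _ := sq_dotProduct_mulVec_le hP x G
      _ ≤ x ⬝ᵥ (H⁻¹ *ᵥ x) * β ^ 2 := by gcongr
      _ = _ := mul_comm _ _
  have h2 : |lam * (x ⬝ᵥ (H⁻¹ *ᵥ θ))| ≤ √lam * S * √(x ⬝ᵥ (H⁻¹ *ᵥ x)) := by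
    refine abs_le_of_sq_le_sq ?_ (by positivity)
    rw [mul_pow, mul_pow, mul_pow, Real.sq_sqrt hx, Real.sq_sqrt hlam.le]
    have h3 := mul_dotProduct_inv_mulVec_le hH hlam hle θ
    calc _ ≤ lam ^ 2 * (x ⬝ᵥ (H⁻¹ *ᵥ x) * (θ ⬝ᵥ (H⁻¹ *ᵥ θ))) := by
          gcongr; exact sq_dotProduct_mulVec_le hP x θ
      _ = lam * (lam * (θ ⬝ᵥ (H⁻¹ *ᵥ θ))) * (x ⬝ᵥ (H⁻¹ *ᵥ x)) := by ring
      _ ≤ lam * S ^ 2 * (x ⬝ᵥ (H⁻¹ *ᵥ x)) := by gcongr; exact h3.trans hθ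
  rw [hb, add_mul]
  exact (abs_sub _ _).trans (add_le_add h1 h2)

end Deterministic

/-! ### The client model -/

section Model

variable {Ω : Type*} {N : ℕ} {c : ℕ → Fin N → Ω → EuclideanSpace ℝ (Fin 3)}
  {sel : ℕ → Ω → Finset (Fin N)} {ε : ℕ → Fin N → Ω → ℝ}

lemma measurable_context_clientHistory {s t : ℕ} (hs : 1 ≤ s) (hst : s ≤ t) (n : Fin N) :
    Measurable[clientHistory c sel ε t n] (c s n) :=
  measurable_iff_comap_le.2 <| le_sup_of_le_left <| le_sup_of_le_left <|
    le_iSup₂_of_le s (Set.mem_Icc.2 ⟨hs, hst⟩) le_rfl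

lemma measurable_selInd_clientHistory {s t : ℕ} (hs : 1 ≤ s) (hst : s ≤ t) (n : Fin N) :
    Measurable[clientHistory c sel ε t n] fun ω => selInd (sel s ω) n :=
  measurable_iff_comap_le.2 <| le_sup_of_le_left <| le_sup_of_le_right <|
    le_iSup₂_of_le s (Set.mem_Icc.2 ⟨hs, hst⟩) le_rfl

lemma measurable_noise_clientHistory {s t : ℕ} (hs : 1 ≤ s) (hst : s < t) (n : Fin N) :
    Measurable[clientHistory c sel ε t n] (ε s n) :=
  measurable_iff_comap_le.2 <| le_sup_of_le_right <|
    le_iSup₂_of_le s (Set.mem_Ico.2 ⟨hs, hst⟩) le_rfl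

lemma clientHistory_le [mΩ : MeasurableSpace Ω] (hc : ∀ t n, 1 ≤ t → Measurable (c t n))
    (hsel : ∀ t n, 1 ≤ t → MeasurableSet {ω | n ∈ sel t ω})
    (hε : ∀ t n, 1 ≤ t → Measurable (ε t n)) (t : ℕ) (n : Fin N) :
    clientHistory c sel ε t n ≤ mΩ := by
  refine sup_le (sup_le ?_ ?_) ?_
  · exact iSup₂_le fun s hs => (hc s n hs.1).comap_le
  · refine iSup₂_le fun s hs => Measurable.comap_le ?_
    exact Measurable.ite (hsel s n hs.1) measurable_const measurable_const
  · exact iSup₂_le fun s hs => (hε s n hs.1).comap_le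

/-- The context of client `n` in round `s` if it is selected, and `0` otherwise. -/
def selectedContext (c : ℕ → Fin N → Ω → EuclideanSpace ℝ (Fin 3))
    (sel : ℕ → Ω → Finset (Fin N)) (n : Fin N) (s : ℕ) (ω : Ω) : Fin 3 → ℝ :=
  selInd (sel s ω) n • (c s n ω).ofLp

lemma selInd_mul_self (A : Finset (Fin N)) (n : Fin N) :
    selInd A n * selInd A n = selInd A n := by
  unfold selInd; split_ifs <;> simp

lemma measurable_selectedContext {s t : ℕ} (hs : 1 ≤ s) (hst : s ≤ t) (n : Fin N) (i : Fin 3) :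
    Measurable[clientHistory c sel ε t n] fun ω => selectedContext c sel n s ω i := by
  refine (measurable_selInd_clientHistory hs hst n).mul ?_
  exact (EuclideanSpace.proj (𝕜 := ℝ) i).continuous.measurable.comp
    (measurable_context_clientHistory hs hst n)

lemma dotProduct_ofLp_self (v : EuclideanSpace ℝ (Fin 3)) : v.ofLp ⬝ᵥ v.ofLp = ‖v‖ ^ 2 := by
  rw [EuclideanSpace.real_norm_sq_eq]
  simp only [dotProduct, sq]

lemma selectedContext_dotProduct_le {L : ℝ} {n : Fin N} {s : ℕ} {ω : Ω} (h : ‖c s n ω‖ ≤ L) :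
    selectedContext c sel n s ω ⬝ᵥ selectedContext c sel n s ω ≤ L ^ 2 := by
  rw [selectedContext, smul_dotProduct, dotProduct_smul, smul_smul, selInd_mul_self,
    dotProduct_ofLp_self, smul_eq_mul]
  have h1 : ‖c s n ω‖ ^ 2 ≤ L ^ 2 := by gcongr
  unfold selInd
  split_ifs
  · simpa using h1
  · simpa using sq_nonneg L

/-- The indicator is idempotent, so it can be moved into both factors of the outer product. -/
lemma designMatrix_eq_regGram (lam : ℝ) (T : ℕ) (n : Fin N) (ω : Ω) :
    designMatrix lam c sel T n ω = regGram lam (fun s => selectedContext c sel n s ω) T := by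
  simp only [designMatrix, regGram, selectedContext, Matrix.smul_vecMulVec, Matrix.vecMulVec_smul,
    smul_smul, selInd_mul_self]

/-- Each response is noise plus `y yᵀ θ`, and the matrices `y yᵀ` sum to the design matrix minus
`lam I`. This is the form of input that `abs_ridge_sub_le` takes. -/
lemma responseVec_eq (lam : ℝ) (θ : Fin N → EuclideanSpace ℝ (Fin 3)) (T : ℕ) (n : Fin N) (ω : Ω) :
    responseVec c sel (exchangeTime c θ ε) T n ω =
      noiseSum (fun s => selectedContext c sel n s ω) (fun s => ε s n ω) T +
        (designMatrix lam c sel T n ω *ᵥ (θ n).ofLp - lam • (θ n).ofLp) := by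
  rw [designMatrix_eq_regGram]
  simp only [responseVec, noiseSum, regGram, Matrix.add_mulVec, Matrix.smul_mulVec,
    Matrix.one_mulVec, Matrix.sum_mulVec, Matrix.vecMulVec_mulVec, add_sub_cancel_left,
    op_smul_eq_smul]
  rw [← Finset.sum_add_distrib]
  refine Finset.sum_congr rfl fun s _ => ?_
  simp only [selectedContext, exchangeTime, expectedTime, smul_dotProduct, smul_smul, smul_eq_mul]
  rw [← add_smul]
  congr 1
  linear_combination (-((c s n ω).ofLp ⬝ᵥ (θ n).ofLp)) * selInd_mul_self (sel s ω) n

variable [mΩ : MeasurableSpace Ω] {μ : Measure Ω} [IsProbabilityMeasure μ]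

/-- With probability at least `1 - δ`, the self-normalised noise of client `n` is bounded in all
rounds. -/
theorem le_measure_forall_noise_le {R L lam δ : ℝ} (hR : 0 ≤ R) (hlam : 0 < lam) (hδ : 0 < δ)
    (hδ1 : δ < 1) (hc : ∀ t n, 1 ≤ t → Measurable (c t n))
    (hsel : ∀ t n, 1 ≤ t → MeasurableSet {ω | n ∈ sel t ω})
    (hε : ∀ t n, 1 ≤ t → Measurable (ε t n))
    (hcL : ∀ t n, 1 ≤ t → ∀ᵐ ω ∂μ, ‖c t n ω‖ ≤ L)
    (hsub : ∀ t n, 1 ≤ t → CondSubGaussian μ (clientHistory c sel ε t n) (ε t n) R) (n : Fin N) :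
    ENNReal.ofReal (1 - δ) ≤ μ {ω | ∀ T : ℕ,
      noiseSum (fun s => selectedContext c sel n s ω) (fun s => ε s n ω) T ⬝ᵥ
        ((designMatrix lam c sel T n ω)⁻¹ *ᵥ
          noiseSum (fun s => selectedContext c sel n s ω) (fun s => ε s n ω) T) ≤
        R ^ 2 * (3 * Real.log ((1 + T * L ^ 2 / lam) / δ))} := by
  rcases hR.eq_or_lt with rfl | hR
  · have hz : ∀ᵐ ω ∂μ, ∀ s, 1 ≤ s → ε s n ω = 0 :=
      ae_all_iff.2 fun s => Filter.eventually_imp_distrib_left.2 fun hs =>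
        (hsub s n hs).ae_eq_zero (clientHistory_le hc hsel hε s n)
    have h1 : ENNReal.ofReal (1 - δ) ≤ μ Set.univ := by
      rw [measure_univ, ENNReal.ofReal_le_one]; linarith
    refine h1.trans (measure_mono_ae ?_)
    filter_upwards [hz] with ω hω _ T
    have : noiseSum (fun s => selectedContext c sel n s ω) (fun s => ε s n ω) T = 0 :=
      Finset.sum_eq_zero fun s hs => by
        simp only [hω s (Finset.mem_Icc.1 hs).1, zero_smul]
    simp [this]
  · have hbad := measure_exists_le_mixtureProcess (μ := μ) hlam hδ
      (m := fun t => clientHistory c sel ε t n) (y := selectedContext c sel n)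
      (η := fun s ω => ε s n ω / R) (fun t _ => clientHistory_le hc hsel hε t n)
      (fun s t h1 h2 i => measurable_selectedContext h1 h2 n i)
      (fun s t h1 h2 => (measurable_noise_clientHistory h1 h2 n).div_const R)
      (fun t ht => (hsub t n ht).div_self hR)
    set bad := {ω | ∃ T, 1 / δ ≤
      mixtureProcess lam (fun s => selectedContext c sel n s ω) (fun s => ε s n ω / R) T}
    have hgood : ENNReal.ofReal (1 - δ) ≤ μ badᶜ := by
      rw [ENNReal.ofReal_sub _ hδ.le, ENNReal.ofReal_one, tsub_le_iff_left]
      -- Subadditivity suffices here, so `bad` need not be shown measurable.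
      calc (1 : ENNReal) = μ (bad ∪ badᶜ) := by rw [Set.union_compl_self, measure_univ]
        _ ≤ μ bad + μ badᶜ := measure_union_le _ _
        _ ≤ _ := by gcongr
    refine hgood.trans (measure_mono_ae ?_)
    have hL : ∀ᵐ ω ∂μ, ∀ s, 1 ≤ s → ‖c s n ω‖ ≤ L :=
      ae_all_iff.2 fun s => Filter.eventually_imp_distrib_left.2 fun hs => hcL s n hs
    filter_upwards [hL] with ω hω hmem T
    have hlt : mixtureProcess lam (fun s => selectedContext c sel n s ω)
        (fun s => ε s n ω / R) T < 1 / δ := by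
      by_contra hle
      exact hmem ⟨T, not_lt.1 hle⟩
    have hb := inv_form_le_of_mixtureProcess_lt hlam hδ hδ1.le (by simp)
      (fun s hs => selectedContext_dotProduct_le (hω s hs)) hlt
    have hscale : noiseSum (fun s => selectedContext c sel n s ω) (fun s => ε s n ω) T =
        R • noiseSum (fun s => selectedContext c sel n s ω) (fun s => ε s n ω / R) T := by
      rw [noiseSum, noiseSum, Finset.smul_sum]
      refine Finset.sum_congr rfl fun s _ => ?_
      rw [smul_smul, mul_div_cancel₀ _ hR.ne']
    rw [hscale, designMatrix_eq_regGram]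
    simp only [Matrix.mulVec_smul, smul_dotProduct, dotProduct_smul, smul_eq_mul, ← mul_assoc,
      ← sq]
    rw [mul_assoc (R ^ 2)]
    gcongr
    simpa using hb

/-- Positive exchange times have nonnegative conditional expectation. -/
lemma ae_expectedTime_nonneg {θ : Fin N → EuclideanSpace ℝ (Fin 3)} {R L : ℝ}
    (hc : ∀ t n, 1 ≤ t → Measurable (c t n))
    (hsel : ∀ t n, 1 ≤ t → MeasurableSet {ω | n ∈ sel t ω})
    (hε : ∀ t n, 1 ≤ t → Measurable (ε t n))
    (hcL : ∀ t n, 1 ≤ t → ∀ᵐ ω ∂μ, ‖c t n ω‖ ≤ L)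
    (hmean : ∀ t n, 1 ≤ t → μ[ε t n | clientHistory c sel ε t n] =ᵐ[μ] 0)
    (hsub : ∀ t n, 1 ≤ t → CondSubGaussian μ (clientHistory c sel ε t n) (ε t n) R)
    (hpos : ∀ t n, 1 ≤ t → ∀ᵐ ω ∂μ, 0 < exchangeTime c θ ε t n ω) {t : ℕ} (ht : 1 ≤ t)
    (n : Fin N) : ∀ᵐ ω ∂μ, 0 ≤ expectedTime (c t n ω) (θ n) := by
  have hm := clientHistory_le hc hsel hε t n
  have hcont : Continuous fun x : EuclideanSpace ℝ (Fin 3) => expectedTime x (θ n) := by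
    unfold expectedTime dotProduct
    fun_prop
  have hmeas : Measurable[clientHistory c sel ε t n] fun ω => expectedTime (c t n ω) (θ n) :=
    hcont.measurable.comp (measurable_context_clientHistory ht le_rfl n)
  have hint : Integrable (fun ω => expectedTime (c t n ω) (θ n)) μ := by
    refine (integrable_const (L * ‖θ n‖)).mono' (hmeas.mono hm le_rfl).aestronglyMeasurable ?_
    filter_upwards [hcL t n ht] with ω hω
    have h1 := sq_dotProduct_le (c t n ω).ofLp (θ n).ofLp
    rw [dotProduct_ofLp_self, dotProduct_ofLp_self, ← mul_pow] at h1
    refine (abs_le_of_sq_le_sq h1 (by positivity)).trans ?_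
    gcongr
  have hεi := (hsub t n ht).integrable (hε t n ht)
  -- The context of round `t` belongs to the history and the noise is centred, so this conditional
  -- expectation is the expected time itself.
  have hnn : 0 ≤ᵐ[μ] μ[(fun ω => expectedTime (c t n ω) (θ n)) + ε t n |
      clientHistory c sel ε t n] := by
    refine condExp_nonneg ?_
    filter_upwards [hpos t n ht] with ω hω
    exact hω.le
  filter_upwards [hnn, condExp_add hint hεi (clientHistory c sel ε t n), hmean t n ht]
    with ω h1 h2 h3
  rw [h2, Pi.add_apply, condExp_of_stronglyMeasurable hm hmeas.stronglyMeasurable hint, h3] at h1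
  simpa using h1

end Model

end ClientSelection

theorem mainTheorem3 {Ω : Type*} [MeasurableSpace Ω] (μ : Measure Ω) [IsProbabilityMeasure μ]
    (N : ℕ) (R S L lam δ : ℝ)
    (hR : 0 ≤ R) (hS : 0 < S) (hL : 0 < L) (hlam : 0 < lam) (hδ : 0 < δ) (hδ1 : δ < 1)
    (θ : Fin N → EuclideanSpace ℝ (Fin 3))
    (c : ℕ → Fin N → Ω → EuclideanSpace ℝ (Fin 3))
    (sel : ℕ → Ω → Finset (Fin N))
    (ε : ℕ → Fin N → Ω → ℝ)
    (hc : ∀ t n, 1 ≤ t → Measurable (c t n))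
    (hsel : ∀ t n, 1 ≤ t → MeasurableSet {ω | n ∈ sel t ω})
    (hε : ∀ t n, 1 ≤ t → Measurable (ε t n))
    (hθS : ∀ n, ‖θ n‖ ≤ S)
    (hcL : ∀ t n, 1 ≤ t → ∀ᵐ ω ∂μ, ‖c t n ω‖ ≤ L)
    (hmean : ∀ t n, 1 ≤ t →
      μ[ε t n | ClientSelection.clientHistory c sel ε t n] =ᵐ[μ] 0)
    (hsub : ∀ t n, 1 ≤ t →
      ClientSelection.CondSubGaussian μ (ClientSelection.clientHistory c sel ε t n) (ε t n) R)
    (hpos : ∀ t n, 1 ≤ t → ∀ᵐ ω ∂μ, 0 < ClientSelection.exchangeTime c θ ε t n ω)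
    (n : Fin N) :
    ENNReal.ofReal (1 - δ) ≤
      μ {ω | ∀ t : ℕ, 1 ≤ t →
        0 ≤ ClientSelection.expectedTime (c t n ω) (θ n) -
            ClientSelection.ucbEstimate lam (ClientSelection.explorationParam R S L lam δ) c sel
              (ClientSelection.exchangeTime c θ ε) t n ω ∧
        ClientSelection.expectedTime (c t n ω) (θ n) -
            ClientSelection.ucbEstimate lam (ClientSelection.explorationParam R S L lam δ) c sel
              (ClientSelection.exchangeTime c θ ε) t n ω ≤
          2 * ClientSelection.explorationParam R S L lam δ t *
            ClientSelection.weightedNorm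
              (ClientSelection.designMatrix lam c sel (t - 1) n ω)⁻¹ (c t n ω)} := by
  have hnn : ∀ᵐ ω ∂μ, ∀ t, 1 ≤ t → 0 ≤ ClientSelection.expectedTime (c t n ω) (θ n) :=
    ae_all_iff.2 fun t => Filter.eventually_imp_distrib_left.2 fun ht =>
      ClientSelection.ae_expectedTime_nonneg hc hsel hε hcL hmean hsub hpos ht n
  refine (ClientSelection.le_measure_forall_noise_le hR hlam hδ hδ1 hc hsel hε hcL hsub n).trans
    (measure_mono_ae ?_)
  filter_upwards [hnn] with ω hω hgood t ht
  have hH : (ClientSelection.designMatrix lam c sel (t - 1) n ω).PosDef := by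
    rw [ClientSelection.designMatrix_eq_regGram]
    exact ClientSelection.posDef_regGram hlam _ _
  have hle : ∀ v, lam * (v ⬝ᵥ v) ≤ v ⬝ᵥ (ClientSelection.designMatrix lam c sel (t - 1) n ω *ᵥ v) := by
    intro v
    rw [ClientSelection.designMatrix_eq_regGram, ClientSelection.dotProduct_regGram_mulVec]
    exact le_add_of_nonneg_right (Finset.sum_nonneg fun s _ => sq_nonneg _)
  have hlog : 0 ≤ Real.log ((1 + (t : ℝ) * L ^ 2 / lam) / δ) := by
    refine Real.log_nonneg ((one_le_div hδ).2 ?_)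
    have : 0 ≤ (t : ℝ) * L ^ 2 / lam := by positivity
    linarith
  -- The estimate of round `t` uses `t - 1` rounds of data, while `explorationParam` carries `t`;
  -- the logarithm is monotone in the round.
  have hG := (hgood (t - 1)).trans (show
      R ^ 2 * (3 * Real.log ((1 + ((t - 1 : ℕ) : ℝ) * L ^ 2 / lam) / δ)) ≤
        (R * √(3 * Real.log ((1 + (t : ℝ) * L ^ 2 / lam) / δ))) ^ 2 by
    rw [mul_pow, Real.sq_sqrt (by positivity)]
    gcongr
    exact Nat.sub_le t 1)
  have hθ : (θ n).ofLp ⬝ᵥ (θ n).ofLp ≤ S ^ 2 := by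
    rw [ClientSelection.dotProduct_ofLp_self]
    gcongr
    exact hθS n
  have key := ClientSelection.abs_ridge_sub_le hH hlam (by positivity) hS.le hle hG hθ
    (c t n ω).ofLp
  rw [← ClientSelection.responseVec_eq lam θ (t - 1) n ω] at key
  have key' : |ClientSelection.expectedTime (c t n ω) (ClientSelection.ridgeEstimate lam c sel
      (ClientSelection.exchangeTime c θ ε) t n ω) - ClientSelection.expectedTime (c t n ω) (θ n)| ≤
      ClientSelection.explorationParam R S L lam δ t * ClientSelection.weightedNorm
        (ClientSelection.designMatrix lam c sel (t - 1) n ω)⁻¹ (c t n ω) := key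
  obtain ⟨h1, h2⟩ := abs_le.1 key'
  rw [ClientSelection.ucbEstimate]
  constructor
  -- Both entries of the maximum lie below the expected time: the index by the error bound, `0` by
  -- positivity of the exchange times.
  · rw [sub_nonneg]
    exact max_le (by linarith) (hω t ht)
  -- Clipping only raises the estimate, so the gap is at most that of the unclipped index: one width
  -- from the error and one from the bonus.
  · have := le_max_left (ClientSelection.expectedTime (c t n ω) (ClientSelection.ridgeEstimate lam c
      sel (ClientSelection.exchangeTime c θ ε) t n ω) -
      ClientSelection.explorationParam R S L lam δ t * ClientSelection.weightedNorm
        (ClientSelection.designMatrix lam c sel (t - 1) n ω)⁻¹ (c t n ω)) 0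
    linarith
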